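/- **Conventions.** All inner products are linear in the first variable. If $G$ is a topological group, $B(G)$ denotes the set of all functions $\pi_{\xi,\eta}(x)=\langle \pi(x)\xi,\eta\rangle$ on $G$, where $\pi$ is a unitary representation of $G$ on a complex Hilbert space $\mathcal H$ all of whose coefficient functions are continuous and $\xi,\eta\in\mathcal H$, with the norm $\|\varphi\|_{B(G)}=\inf\{\|\xi\|\,\|\eta\| : \varphi=\pi_{\xi,\eta}\}$. A groupoid $\mathcal G$ has range and source maps $r(a)=aa^{-1}$, $s(a)=a^{-1}a$ and unit space $\mathcal G^{(0)}=r(\mathcal G)$; it is a topological groupoid if inversion and the partial product are continuous. A continuous Hilbert field $\mathfrak H$ over a topological space $S$ is a family $(\mathfrak H_t)_{t\in S}$ of complex Hilbert spaces with a linear subspace $\Gamma\subseteq\prod_t\mathfrak H_t$ such that $\{\xi(t):\xi\in\Gamma\}$ is dense in $\mathfrak H_t$ for each $t$; $t\mapsto\|\xi(t)\|$ is continuous for each $\xi\in\Gamma$; and every $\xi\in\prod_t\mathfrak H_t$ that, near each point and for each $\varepsilon>0$, is within $\varepsilon$ in norm of some member of $\Gamma$, lies in $\Gamma$. Let $\Delta_b(\mathfrak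 H)$ be the set of $\xi\in\Gamma$ with $\|\xi\|_\Delta:=\sup_t\|\xi(t)\|<\infty$. A representation of $\mathcal G$ on a continuous Hilbert field $\mathfrak H$ over $\mathcal G^{(0)}$ is a family of unitaries $\varpi(x):\mathfrak H_{s(x)}\to\mathfrak H_{r(x)}$ $(x\in\mathcal G)$ with $\varpi(xy)=\varpi(x)\varpi(y)$ for composable $x,y$, such that for all $\xi,\eta\in\Delta_b(\mathfrak H)$ the coefficient $\varpi_{\xi,\eta}(x)=\langle\varpi(x)\xi(s(x)),\eta(r(x))\rangle$ is continuous on $\mathcal G$. The Fourier–Stieltjes algebra $B(\mathcal G)$ is the set of all such coefficients $\varpi_{\xi,\eta}$ with $\xi,\eta\in\Delta_b(\mathfrak H)$, with pointwise operations and the norm $\|\varphi\|_{B(\mathcal G)}=\inf\{\|\xi\|_\Delta\|\eta\|_\Delta:\varphi=\varpi_{\xi,\eta}\}$. **Statement.** Let $\{G_t\}_{t\in T}$ be a family of locally compact Hausdorff groups and let $\mathcal G=\bigsqcup_{t\in T}\{t\}\times G_t$ be the group bundle they form, i.e. the groupoid with product $(t,x)(t,y)=(t,xy)$ and inverse $(t,x)^{-1}=(t,x^{-1})$.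 Suppose that $\mathcal G$ carries a locally compact Hausdorff topology that makes it a topological groupoid and induces on each $G_t$ its given topology, and that the unit space $\mathcal G^{(0)}$ is discrete in the subspace topology. For $u_t\in B(G_t)$ $(t\in T)$ let $\boxplus_{t}u_t:\mathcal G\to\mathbb C$ be the function that equals $u_t$ on $G_t$, and let $$\ell^\infty\text{-}\boxplus_{t\in T}B(G_t)=\Big\{\boxplus_{t}u_t : u_t\in B(G_t),\ \sup_{t}\|u_t\|_{B(G_t)}<\infty\Big\},\qquad \Big\|\boxplus_{t}u_t\Big\|_\boxplus=\sup_{t}\|u_t\|_{B(G_t)},$$ with componentwise operations. Then $B(\mathcal G)$ and $\ell^\infty\text{-}\boxplus_{t\in T}B(G_t)$ are unital Banach algebras, and the map $$\Phi:B(\mathcal G)\to\ell^\infty\text{-}\boxplus_{t\in T}B(G_t),\qquad \Phi(\varphi)=\boxplus_{t\in T}\,\varphi|_{G_t},$$ is an isometric isomorphism of Banach algebras. -/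

import Mathlib

open Topology Filter

universe u

/-! ### Groupoids -/

/-- A (set-theoretic) groupoid: a set with a partially defined product and an involutive inverse. -/
class PartialGroupoid (𝒢 : Type u) where
  /-- the set of composable pairs -/
  composable : Set (𝒢 × 𝒢)
  /-- the partial product -/
  mul : composable → 𝒢
  /-- the inverse -/
  inv : 𝒢 → 𝒢
  inv_inv : ∀ a, inv (inv a) = a
  assoc : ∀ (a b c : 𝒢) (hab : (a, b) ∈ composable) (hbc : (b, c) ∈ composable),
    ∃ (h₁ : (mul ⟨(a, b), hab⟩, c) ∈ composable) (h₂ : (a, mul ⟨(b, c), hbc⟩) ∈ composable),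
      mul ⟨_, h₁⟩ = mul ⟨_, h₂⟩
  composable_inv : ∀ b, (b, inv b) ∈ composable
  inv_mul_cancel : ∀ (a b : 𝒢) (hab : (a, b) ∈ composable),
    ∃ h : (inv a, mul ⟨(a, b), hab⟩) ∈ composable, mul ⟨_, h⟩ = b
  mul_inv_cancel : ∀ (a b : 𝒢) (hab : (a, b) ∈ composable),
    ∃ h : (mul ⟨(a, b), hab⟩, inv b) ∈ composable, mul ⟨_, h⟩ = a

namespace PartialGroupoid

variable {𝒢 : Type u} [PartialGroupoid 𝒢]

/-- The product of a composable pair. -/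
def prod (a b : 𝒢) (h : (a, b) ∈ composable (𝒢 := 𝒢)) : 𝒢 := mul ⟨(a, b), h⟩

theorem composable_inv_left (a : 𝒢) : (inv a, a) ∈ composable (𝒢 := 𝒢) := by
  have h := composable_inv (inv a)
  rwa [inv_inv] at h

theorem prod_congr {a a' b b' : 𝒢} (ha : a = a') (hb : b = b')
    (h : (a, b) ∈ composable (𝒢 := 𝒢)) (h' : (a', b') ∈ composable (𝒢 := 𝒢)) :
    prod a b h = prod a' b' h' := by
  subst ha; subst hb; rfl

variable (𝒢) in
/-- The unit space `{a a⁻¹ : a ∈ 𝒢}`. -/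
def unitSpace : Set 𝒢 := Set.range fun a : 𝒢 => prod a (inv a) (composable_inv a)

/-- The range map `r(a) = a a⁻¹`. -/
def range (a : 𝒢) : unitSpace 𝒢 := ⟨prod a (inv a) (composable_inv a), a, rfl⟩

/-- The source map `s(a) = a⁻¹ a`. -/
def source (a : 𝒢) : unitSpace 𝒢 :=
  ⟨prod (inv a) a (composable_inv_left a), inv a, prod_congr rfl (inv_inv a) _ _⟩

theorem source_eq_range {x y : 𝒢} (h : (x, y) ∈ composable (𝒢 := 𝒢)) : source x = range y := by
  apply Subtype.ext
  obtain ⟨h₁, e₁⟩ := inv_mul_cancel x y h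
  obtain ⟨h₂, h₃, e₂⟩ := assoc (inv x) x y (composable_inv_left x) h
  obtain ⟨h₄, e₄⟩ := mul_inv_cancel _ _ h₂
  have e₅ : mul ⟨_, h₂⟩ = y := by rw [e₂]; exact e₁
  exact e₄.symm.trans (prod_congr e₅ rfl h₄ (composable_inv y))

theorem range_prod {x y : 𝒢} (h : (x, y) ∈ composable (𝒢 := 𝒢)) :
    range (prod x y h) = range x := by
  obtain ⟨h₁, e₁⟩ := mul_inv_cancel x y h
  obtain ⟨-, h₂, -⟩ := assoc _ _ _ (composable_inv_left (mul ⟨(x, y), h⟩)) h₁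
  have key : (inv (prod x y h), x) ∈ composable (𝒢 := 𝒢) := by
    rw [e₁] at h₂
    exact h₂
  rw [← source_eq_range key]
  apply Subtype.ext
  exact prod_congr (inv_inv _).symm rfl _ _

theorem source_prod {x y : 𝒢} (h : (x, y) ∈ composable (𝒢 := 𝒢)) :
    source (prod x y h) = source y := by
  obtain ⟨h₁, e₁⟩ := inv_mul_cancel x y h
  obtain ⟨h₂, -, -⟩ := assoc _ _ _ h₁ (composable_inv (mul ⟨(x, y), h⟩))
  have key : (y, inv (prod x y h)) ∈ composable (𝒢 := 𝒢) := by
    rw [e₁] at h₂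
    exact h₂
  rw [source_eq_range key]
  apply Subtype.ext
  exact prod_congr rfl (inv_inv _).symm _ _

end PartialGroupoid

/-- A topological groupoid: inverse and partial product are continuous. -/
class IsTopologicalGroupoid (𝒢 : Type u) [PartialGroupoid 𝒢] [TopologicalSpace 𝒢] : Prop where
  continuous_inv : Continuous (PartialGroupoid.inv : 𝒢 → 𝒢)
  continuous_mul :
    Continuous (PartialGroupoid.mul : PartialGroupoid.composable (𝒢 := 𝒢) → 𝒢)

/-! ### Continuous fields of Hilbert spaces and groupoid representations -/

/-- A continuous field of complex Hilbert spaces over a topological space `S`. -/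
structure ContinuousHilbertField (S : Type u) [TopologicalSpace S] where
  fiber : S → Type u
  [normed : ∀ t, NormedAddCommGroup (fiber t)]
  [inner : ∀ t, InnerProductSpace ℂ (fiber t)]
  [complete : ∀ t, CompleteSpace (fiber t)]
  /-- the continuous sections -/
  sections : Submodule ℂ (∀ t, fiber t)
  dense : ∀ t, Dense {v : fiber t | ∃ x ∈ sections, x t = v}
  continuous_norm : ∀ x ∈ sections, Continuous fun t => ‖x t‖
  mem_of_locally_approx : ∀ x : ∀ t, fiber t,
    (∀ t, ∀ ε : ℝ, 0 < ε → ∃ x' ∈ sections, ∀ᶠ τ in 𝓝 t, ‖x τ - x' τ‖ < ε) → x ∈ sections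

attribute [instance] ContinuousHilbertField.normed ContinuousHilbertField.inner
  ContinuousHilbertField.complete

namespace ContinuousHilbertField

variable {S : Type u} [TopologicalSpace S] (H : ContinuousHilbertField S)

/-- The bounded continuous sections `Δ_b`. -/
def boundedSections : Set (∀ t, H.fiber t) :=
  {ξ | ξ ∈ H.sections ∧ BddAbove (Set.range fun t => ‖ξ t‖)}

/-- The supremum norm of a section. -/
noncomputable def sectionNorm (ξ : ∀ t, H.fiber t) : ℝ := ⨆ t, ‖ξ t‖

end ContinuousHilbertField

open PartialGroupoid in
/-- A continuous unitary representation of a groupoid on a continuous Hilbert field over its unit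
space (a `𝒢`-Hilbert bundle). The unitary attached to `x` goes from the fiber at `s(x)` to the
fiber at `r(x)`; it is written `op x u v _ _` whenever `s(x) = u` and `r(x) = v`. -/
structure GroupoidRep (𝒢 : Type u) [PartialGroupoid 𝒢] [TopologicalSpace 𝒢] where
  field : ContinuousHilbertField (unitSpace 𝒢)
  op : ∀ (x : 𝒢) (u v : unitSpace 𝒢), source x = u → range x = v →
    (field.fiber u ≃ₗᵢ[ℂ] field.fiber v)
  continuous_coeff : ∀ ξ ∈ field.boundedSections, ∀ η ∈ field.boundedSections,
    Continuous fun x : 𝒢 =>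
      inner ℂ (η (range x)) (op x (source x) (range x) rfl rfl (ξ (source x)))
  op_prod : ∀ (x y : 𝒢) (h : (x, y) ∈ composable (𝒢 := 𝒢)) (v : field.fiber (source y)),
    op (prod x y h) (source y) (range x) (source_prod h) (range_prod h) v =
      op x (range y) (range x) (source_eq_range h) rfl
        (op y (source y) (range y) rfl rfl v)

namespace GroupoidRep

variable {𝒢 : Type u} [PartialGroupoid 𝒢] [TopologicalSpace 𝒢]

open PartialGroupoid in
/-- The coefficient `x ↦ ⟨ϖ(x) ξ(s(x)), η(r(x))⟩`. Mathlib's inner product is conjugate-linear in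
its first argument, hence the order of the arguments. -/
noncomputable def coeff (ϖ : GroupoidRep 𝒢) (ξ η : ∀ u, ϖ.field.fiber u) (x : 𝒢) : ℂ :=
  inner ℂ (η (range x)) (ϖ.op x (source x) (range x) rfl rfl (ξ (source x)))

end GroupoidRep

/-- The Fourier-Stieltjes algebra `B(𝒢)` of a topological groupoid, as a set of functions. -/
def groupoidFS (𝒢 : Type u) [PartialGroupoid 𝒢] [TopologicalSpace 𝒢] : Set (𝒢 → ℂ) :=
  {φ | ∃ (ϖ : GroupoidRep 𝒢), ∃ ξ ∈ ϖ.field.boundedSections, ∃ η ∈ ϖ.field.boundedSections,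
    φ = ϖ.coeff ξ η}

/-- The norm of `B(𝒢)`. -/
noncomputable def groupoidFSNorm {𝒢 : Type u} [PartialGroupoid 𝒢] [TopologicalSpace 𝒢]
    (φ : 𝒢 → ℂ) : ℝ :=
  sInf {c | ∃ (ϖ : GroupoidRep 𝒢), ∃ ξ ∈ ϖ.field.boundedSections,
    ∃ η ∈ ϖ.field.boundedSections, φ = ϖ.coeff ξ η ∧
      c = ϖ.field.sectionNorm ξ * ϖ.field.sectionNorm η}

/-! ### The Fourier-Stieltjes algebra of a topological group -/

/-- A continuous unitary representation of a topological group on a complex Hilbert space. -/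
structure UnitaryRep (G : Type u) [Group G] [TopologicalSpace G] where
  space : Type u
  [normed : NormedAddCommGroup space]
  [inner : InnerProductSpace ℂ space]
  [complete : CompleteSpace space]
  op : G →* (space ≃ₗᵢ[ℂ] space)
  continuous_coeff : ∀ ξ η : space, Continuous fun x : G => Inner.inner ℂ η (op x ξ)

attribute [instance] UnitaryRep.normed UnitaryRep.inner UnitaryRep.complete

/-- The coefficient `x ↦ ⟨π(x) ξ, η⟩`. -/
noncomputable def UnitaryRep.coeff {G : Type u} [Group G] [TopologicalSpace G]
    (π : UnitaryRep G) (ξ η : π.space) (x : G) : ℂ :=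
  Inner.inner ℂ η (π.op x ξ)

/-- The Fourier-Stieltjes algebra `B(G)` of a topological group, as a set of functions. -/
def groupFS (G : Type u) [Group G] [TopologicalSpace G] : Set (G → ℂ) :=
  {φ | ∃ (π : UnitaryRep G) (ξ η : π.space), φ = π.coeff ξ η}

/-- The norm of `B(G)`. -/
noncomputable def groupFSNorm {G : Type u} [Group G] [TopologicalSpace G] (φ : G → ℂ) : ℝ :=
  sInf {c | ∃ (π : UnitaryRep G) (ξ η : π.space), φ = π.coeff ξ η ∧ c = ‖ξ‖ * ‖η‖}

/-! ### Group bundles and box sums -/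

/-- The group bundle `⊔_t {t} × G_t`. It is not given the sum topology: its topology is an
arbitrary one, supplied separately. -/
def GroupBundle {T : Type u} (G : T → Type u) : Type u := Σ t, G t

namespace GroupBundle

variable {T : Type u} {G : T → Type u}

/-- The inclusion of `G_t` in the bundle. -/
def mk (t : T) (x : G t) : GroupBundle G := Sigma.mk t x

variable [∀ t, Group (G t)]

/-- `(t, x)(t, y) = (t, xy)`. -/
def mulAux : ∀ a b : (Σ t, G t), a.1 = b.1 → GroupBundle G
  | ⟨t, x⟩, ⟨_, y⟩, rfl => mk t (x * y)

instance : PartialGroupoid (GroupBundle G) where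
  composable := {p | p.1.1 = p.2.1}
  mul p := mulAux p.1.1 p.1.2 p.2
  inv a := mk a.1 a.2⁻¹
  inv_inv := by
    rintro ⟨t, x⟩
    exact congrArg (mk t) (_root_.inv_inv x)
  assoc := by
    rintro ⟨t, x⟩ ⟨_, y⟩ ⟨_, z⟩ ⟨⟩ ⟨⟩
    exact ⟨rfl, rfl, congrArg (mk t) (mul_assoc x y z)⟩
  composable_inv _ := rfl
  inv_mul_cancel := by
    rintro ⟨t, x⟩ ⟨_, y⟩ ⟨⟩
    exact ⟨rfl, congrArg (mk t) (inv_mul_cancel_left x y)⟩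
  mul_inv_cancel := by
    rintro ⟨t, x⟩ ⟨_, y⟩ ⟨⟩
    exact ⟨rfl, congrArg (mk t) (mul_inv_cancel_right x y)⟩

/-- The function `⊞_t u_t` on the bundle that equals `u_t` on `G_t`. -/
def boxplus (u : ∀ t, G t → ℂ) (x : GroupBundle G) : ℂ := u x.1 x.2

/-- The restriction of a function on the bundle to `G_t`. -/
def restrict (t : T) (φ : GroupBundle G → ℂ) (x : G t) : ℂ := φ (mk t x)

variable [∀ t, TopologicalSpace (G t)]

variable (G) in
/-- The `ℓ^∞` box sum of the algebras `B(G_t)`, as a set of functions. -/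
def boxSum : Set (GroupBundle G → ℂ) :=
  {f | ∃ u : ∀ t, G t → ℂ, (∀ t, u t ∈ groupFS (G t)) ∧
    BddAbove (Set.range fun t => groupFSNorm (u t)) ∧ f = boxplus u}

/-- The box norm `sup_t ‖u_t‖_{B(G_t)}` of `⊞_t u_t`. -/
noncomputable def boxNorm (f : GroupBundle G → ℂ) : ℝ := ⨆ t, groupFSNorm (restrict t f)

end GroupBundle

/-! ### Banach algebras of functions -/

/-- A unital Banach algebra of complex functions on `X`, with pointwise operations: a subalgebra
of `X → ℂ` with a submultiplicative norm, for which Cauchy sequences converge. -/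
structure BanachFunctionAlgebra (X : Type u) where
  alg : Subalgebra ℂ (X → ℂ)
  norm : AlgebraNorm ℂ alg
  complete : ∀ f : ℕ → alg,
    (∀ ε : ℝ, 0 < ε → ∃ N, ∀ m ≥ N, ∀ n ≥ N, norm (f m - f n) < ε) →
      ∃ g : alg, Tendsto (fun n => norm (f n - g)) atTop (𝓝 0)

/-! Since the unit space is discrete and the range map is continuous, each `G_t` is open in the
bundle, so continuity on the bundle can be tested on each group separately. Discreteness also makes
every section of a Hilbert field over the unit space continuous. A representation of the bundle is
therefore the same as an arbitrary family of unitary representations of the groups `G_t`, and a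
bounded continuous section is a uniformly bounded choice of vectors.

Restricting a coefficient of the bundle to `G_t` thus gives a coefficient of `G_t` whose vectors are
the values of the sections at one unit (`groupFSNorm_restrict_coeff_le`). For the converse, a bound
on `‖u_t‖` controls only a product of two norms, while both sections have to be bounded. Rescaling
the two vectors to comparable length (`exists_coeff_sq_le`) solves this, and the families are then
assembled with product of section norms at most `boxNorm f + ε`
(`exists_groupoidRep_coeff_of_mem_boxSum`). So the two sets of functions and the two norms coincide,
and `Φ` is the identity.

It remains to see that the box sum is a Banach algebra, which is checked uniformly over the groups.
Tensor products of representations give products (`groupFS_mul`). Hilbert sums give absolutely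
convergent series with norm at most the sum of the norms (`groupFS_hasSum`); addition is the case of
two terms, and completeness follows from the countable case. -/

/-! ### Building unitary representations -/

/-- The extension of a linear isometry to the completions. -/
noncomputable def LinearIsometry.completionMap {V W : Type*} [NormedAddCommGroup V]
    [NormedSpace ℂ V] [NormedAddCommGroup W] [NormedSpace ℂ W] (f : V →ₗᵢ[ℂ] W) :
    UniformSpace.Completion V →ₗᵢ[ℂ] UniformSpace.Completion W where
  toFun := UniformSpace.Completion.map f
  map_add' a b := by
    have hf := f.isometry.uniformContinuous
    induction a, b using UniformSpace.Completion.induction_on₂ with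
    | hp =>
      have hc := UniformSpace.Completion.continuous_map (f := f)
      exact isClosed_eq (hc.comp continuous_add)
        (Continuous.add (hc.comp continuous_fst) (hc.comp continuous_snd) :)
    | ih a b =>
      rw [← UniformSpace.Completion.coe_add, UniformSpace.Completion.map_coe hf,
        UniformSpace.Completion.map_coe hf, UniformSpace.Completion.map_coe hf, map_add,
        UniformSpace.Completion.coe_add]
  map_smul' c a := by
    have hf := f.isometry.uniformContinuous
    induction a using UniformSpace.Completion.induction_on with
    | hp =>
      have hc := UniformSpace.Completion.continuous_map (f := f)
      exact isClosed_eq (hc.comp (continuous_const_smul c)) (Continuous.const_smul hc c :)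
    | ih a =>
      rw [← UniformSpace.Completion.coe_smul, UniformSpace.Completion.map_coe hf,
        UniformSpace.Completion.map_coe hf, map_smul, UniformSpace.Completion.coe_smul,
        RingHom.id_apply]
  norm_map' a := by
    have hf := f.isometry.uniformContinuous
    induction a using UniformSpace.Completion.induction_on with
    | hp => exact isClosed_eq UniformSpace.Completion.continuous_map.norm continuous_norm
    | ih a =>
      change ‖UniformSpace.Completion.map f a‖ = _
      simp [UniformSpace.Completion.map_coe hf]

@[simp]
theorem LinearIsometry.completionMap_coe {V W : Type*} [NormedAddCommGroup V]
    [NormedSpace ℂ V] [NormedAddCommGroup W] [NormedSpace ℂ W] (f : V →ₗᵢ[ℂ] W) (a : V) :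
    f.completionMap (a : UniformSpace.Completion V) = (f a : UniformSpace.Completion W) :=
  UniformSpace.Completion.map_coe f.isometry.uniformContinuous a

/-- A family of linear isometries indexed by a group and compatible with its operations consists
of unitaries. -/
noncomputable def unitaryHom {G V : Type*} [Group G] [NormedAddCommGroup V] [NormedSpace ℂ V]
    (U : G → V →ₗᵢ[ℂ] V) (h_one : ∀ v, U 1 v = v)
    (h_mul : ∀ x y v, U (x * y) v = U x (U y v)) : G →* (V ≃ₗᵢ[ℂ] V) where
  toFun x :=
    -- An isometry need not be onto; `U x⁻¹` provides the inverse.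
    { toLinearEquiv := LinearEquiv.ofLinearMap (U x).toLinearMap (U x⁻¹).toLinearMap
        (by ext v; change U x (U x⁻¹ v) = v; rw [← h_mul, mul_inv_cancel, h_one])
        (by ext v; change U x⁻¹ (U x v) = v; rw [← h_mul, inv_mul_cancel, h_one])
      norm_map' := (U x).norm_map }
  map_one' := by ext v; exact h_one v
  map_mul' x y := by ext v; exact h_mul x y v

/-! ### Continuity of coefficients under norm limits of vectors. -/

section Continuity

variable {X V : Type*} [TopologicalSpace X] [NormedAddCommGroup V] [InnerProductSpace ℂ V]

/-- The vectors `ξ` for which `x ↦ ⟨U x ξ, η⟩` is continuous form a closed set. -/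
theorem isClosed_setOf_continuous_inner_right (U : X → V →ₗᵢ[ℂ] V) (η : V) :
    IsClosed {ξ : V | Continuous fun x => inner ℂ η (U x ξ)} := by
  refine isClosed_of_closure_subset fun ξ hξ => ?_
  refine continuous_of_uniform_approx_of_continuous fun s hs => ?_
  obtain ⟨ε, hε, hs⟩ := Metric.mem_uniformity_dist.1 hs
  -- The approximation is uniform in `x` because each `U x` is isometric; the `+ 1` avoids division
  -- by zero when `η = 0`.
  obtain ⟨ξ', hξ', hd⟩ := Metric.mem_closure_iff.1 hξ (ε / (‖η‖ + 1)) (by positivity)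
  refine ⟨_, hξ', fun x => hs ?_⟩
  rw [dist_eq_norm, ← inner_sub_right, ← map_sub]
  calc _ ≤ ‖η‖ * ‖U x (ξ - ξ')‖ := norm_inner_le_norm _ _
    _ = ‖η‖ * dist ξ ξ' := by rw [(U x).norm_map, dist_eq_norm]
    _ ≤ (‖η‖ + 1) * dist ξ ξ' := by gcongr; linarith
    _ < (‖η‖ + 1) * (ε / (‖η‖ + 1)) := by gcongr
    _ = ε := by field_simp

/-- The vectors `η` for which `x ↦ ⟨U x ξ, η⟩` is continuous form a closed set. -/
theorem isClosed_setOf_continuous_inner_left (U : X → V →ₗᵢ[ℂ] V) (ξ : V) :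
    IsClosed {η : V | Continuous fun x => inner ℂ η (U x ξ)} := by
  refine isClosed_of_closure_subset fun η hη => ?_
  refine continuous_of_uniform_approx_of_continuous fun s hs => ?_
  obtain ⟨ε, hε, hs⟩ := Metric.mem_uniformity_dist.1 hs
  obtain ⟨η', hη', hd⟩ := Metric.mem_closure_iff.1 hη (ε / (‖ξ‖ + 1)) (by positivity)
  refine ⟨_, hη', fun x => hs ?_⟩
  rw [dist_eq_norm, ← inner_sub_left]
  calc _ ≤ ‖η - η'‖ * ‖U x ξ‖ := norm_inner_le_norm _ _
    _ = dist η η' * ‖ξ‖ := by rw [(U x).norm_map, dist_eq_norm]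
    _ ≤ dist η η' * (‖ξ‖ + 1) := by gcongr; linarith
    _ < ε / (‖ξ‖ + 1) * (‖ξ‖ + 1) := by gcongr
    _ = ε := by field_simp

end Continuity

namespace UnitaryRep

variable {G : Type u} [Group G] [TopologicalSpace G]

theorem op_one_apply (π : UnitaryRep G) (v : π.space) : π.op 1 v = v := by
  rw [map_one]; rfl

theorem op_mul_apply (π : UnitaryRep G) (x y : G) (v : π.space) :
    π.op (x * y) v = π.op x (π.op y v) := by
  rw [map_mul]; rfl

/-! ### Tensor products of unitary representations -/

section Tensor

open TensorProduct UniformSpace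

variable (π ρ : UnitaryRep G)

/-- The isometries of the completed tensor product of two representations. -/
noncomputable def tensorIsometry (x : G) :
    Completion (π.space ⊗[ℂ] ρ.space) →ₗᵢ[ℂ] Completion (π.space ⊗[ℂ] ρ.space) :=
  (mapIsometry (π.op x).toLinearIsometry (ρ.op x).toLinearIsometry).completionMap

theorem tensorIsometry_coe_tmul (x : G) (v : π.space) (w : ρ.space) :
    π.tensorIsometry ρ x ((v ⊗ₜ[ℂ] w : π.space ⊗[ℂ] ρ.space) : Completion _) =
      ((π.op x v ⊗ₜ[ℂ] ρ.op x w : π.space ⊗[ℂ] ρ.space) : Completion _) := by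
  simp [tensorIsometry]

/-- Two linear isometries on a completed tensor product agree if they agree on pure
tensors. -/
theorem completion_tensor_ext {V W Z : Type*} [NormedAddCommGroup V] [InnerProductSpace ℂ V]
    [NormedAddCommGroup W] [InnerProductSpace ℂ W] [NormedAddCommGroup Z] [NormedSpace ℂ Z]
    (f g : Completion (V ⊗[ℂ] W) →ₗᵢ[ℂ] Z)
    (h : ∀ v w, f ((v ⊗ₜ[ℂ] w : V ⊗[ℂ] W) : Completion _) =
      g ((v ⊗ₜ[ℂ] w : V ⊗[ℂ] W) : Completion _)) (z : Completion (V ⊗[ℂ] W)) : f z = g z := by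
  induction z using Completion.induction_on with
  | hp => exact isClosed_eq f.continuous g.continuous
  | ih z =>
    induction z using TensorProduct.induction_on with
    | zero => rw [Completion.coe_zero, map_zero, map_zero]
    | tmul v w => exact h v w
    | add a b ha hb => rw [Completion.coe_add, map_add, map_add, ha, hb]

/-- The completed tensor product of two representations. -/
noncomputable def tensor : UnitaryRep G where
  space := Completion (π.space ⊗[ℂ] ρ.space)
  op := unitaryHom (π.tensorIsometry ρ)
    (completion_tensor_ext _ LinearIsometry.id fun v w => by
      rw [tensorIsometry_coe_tmul, op_one_apply, op_one_apply]; rfl)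
    (fun x y => completion_tensor_ext _ ((π.tensorIsometry ρ x).comp (π.tensorIsometry ρ y))
      fun v w => by
        rw [tensorIsometry_coe_tmul, op_mul_apply, op_mul_apply]
        change _ = π.tensorIsometry ρ x (π.tensorIsometry ρ y _)
        rw [tensorIsometry_coe_tmul, tensorIsometry_coe_tmul])
  continuous_coeff ξ η := by
    change Continuous fun x => Inner.inner ℂ η (π.tensorIsometry ρ x ξ)
    -- Closedness in each vector, then bilinearity, reduces the claim to pure tensors, where the
    -- coefficient is a product of two continuous coefficients.
    induction ξ using Completion.induction_on with
    | hp => exact isClosed_setOf_continuous_inner_right _ _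
    | ih ξ =>
      induction η using Completion.induction_on with
      | hp => exact isClosed_setOf_continuous_inner_left _ _
      | ih η =>
        induction ξ using TensorProduct.induction_on with
        | zero =>
          simpa only [Completion.coe_zero, map_zero, inner_zero_right] using continuous_const
        | add a b ha hb =>
          simp only [Completion.coe_add, map_add, inner_add_right]
          exact ha.add hb
        | tmul v w =>
          simp only [tensorIsometry_coe_tmul, Completion.inner_coe]
          induction η using TensorProduct.induction_on with
          | zero => simpa only [inner_zero_left] using continuous_const
          | add a b ha hb =>
            simp only [inner_add_left]
            exact ha.add hb
          | tmul v' w' =>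
            simp only [inner_tmul]
            exact (π.continuous_coeff v v').mul (ρ.continuous_coeff w w')

/-- The inner product of pure tensors factorises, and their norms are products; this is the source
of submultiplicativity. -/
theorem exists_coeff_eq_mul (ξ η : π.space) (ξ' η' : ρ.space) :
    ∃ (σ : UnitaryRep G) (v w : σ.space), π.coeff ξ η * ρ.coeff ξ' η' = σ.coeff v w ∧
      ‖v‖ = ‖ξ‖ * ‖ξ'‖ ∧ ‖w‖ = ‖η‖ * ‖η'‖ := by
  refine ⟨π.tensor ρ, ((ξ ⊗ₜ[ℂ] ξ' : π.space ⊗[ℂ] ρ.space) : Completion _),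
    ((η ⊗ₜ[ℂ] η' : π.space ⊗[ℂ] ρ.space) : Completion _), ?_, ?_, ?_⟩
  · ext x
    change _ = Inner.inner ℂ _ (π.tensorIsometry ρ x _)
    rw [tensorIsometry_coe_tmul, Completion.inner_coe, inner_tmul]
    rfl
  · exact (Completion.norm_coe _).trans (norm_tmul _ _)
  · exact (Completion.norm_coe _).trans (norm_tmul _ _)

end Tensor

/-! ### Hilbert sums of unitary representations -/

section HilbertSum

variable {ι : Type} (π : ι → UnitaryRep G)

/-- The componentwise isometries of a Hilbert sum. -/
noncomputable def sumIsometry (x : G) :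
    lp (fun i => (π i).space) 2 →ₗᵢ[ℂ] lp (fun i => (π i).space) 2 where
  toFun v := ⟨fun i => (π i).op x (v i), by
    refine Memℓp.of_norm ?_
    simpa only [LinearIsometryEquiv.norm_map] using (lp.memℓp v).norm⟩
  map_add' v w := by ext i; exact map_add ((π i).op x) (v i) (w i)
  map_smul' c v := by ext i; exact map_smul ((π i).op x) c (v i)
  norm_map' v := by
    rw [lp.norm_eq_tsum_rpow (by norm_num), lp.norm_eq_tsum_rpow (by norm_num)]
    congr! 3 with i
    exact congrArg (· ^ _) (((π i).op x).norm_map (v i))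

/-- The Hilbert sum of a family of representations. -/
noncomputable def hilbertSum : UnitaryRep G where
  space := lp (fun i => (π i).space) 2
  op := unitaryHom (sumIsometry π) (fun v => by ext i; exact (π i).op_one_apply (v i))
    (fun x y v => by ext i; exact (π i).op_mul_apply x y (v i))
  continuous_coeff ξ η := by
    change Continuous fun x => ∑' i, Inner.inner ℂ (η i) ((π i).op x (ξ i))
    -- Weierstrass test: the terms are bounded by `‖η i‖ * ‖ξ i‖`, independently of `x`.
    refine continuous_tsum (fun i => (π i).continuous_coeff (ξ i) (η i))
      (lp.summable_mul (by rw [Real.holderConjugate_iff]; norm_num) η ξ) fun i x => ?_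
    refine (norm_inner_le_norm _ _).trans_eq ?_
    rw [(π i).op x |>.norm_map]

/-- Distinct summands of a Hilbert sum are orthogonal, so coefficients and squared norms both add
up. One statement serves finite sums and infinite series. -/
theorem exists_coeff_eq_tsum (ξ η : ∀ i, (π i).space) (hξ : Summable fun i => ‖ξ i‖ ^ 2)
    (hη : Summable fun i => ‖η i‖ ^ 2) :
    ∃ (σ : UnitaryRep G) (v w : σ.space),
      (∀ x, HasSum (fun i => (π i).coeff (ξ i) (η i) x) (σ.coeff v w x)) ∧
      ‖v‖ ^ 2 = ∑' i, ‖ξ i‖ ^ 2 ∧ ‖w‖ ^ 2 = ∑' i, ‖η i‖ ^ 2 := by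
  have mem : ∀ ζ : ∀ i, (π i).space, (Summable fun i => ‖ζ i‖ ^ 2) → Memℓp ζ 2 := fun ζ h =>
    memℓp_gen (by simpa using h)
  have nrm : ∀ v : lp (fun i => (π i).space) 2, ‖v‖ ^ 2 = ∑' i, ‖v i‖ ^ 2 := fun v => by
    simpa using lp.norm_rpow_eq_tsum (p := 2) (by norm_num) v
  refine ⟨hilbertSum π, (⟨ξ, mem ξ hξ⟩ : lp (fun i => (π i).space) 2),
    (⟨η, mem η hη⟩ : lp (fun i => (π i).space) 2), fun x => ?_, nrm _, nrm _⟩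
  exact lp.hasSum_inner (𝕜 := ℂ) (⟨η, mem η hη⟩ : lp (fun i => (π i).space) 2)
    (sumIsometry π x ⟨ξ, mem ξ hξ⟩)

end HilbertSum

/-- The trivial representation. -/
noncomputable def trivial : UnitaryRep G where
  space := EuclideanSpace ℂ PUnit.{u + 1}
  op := 1
  continuous_coeff ξ η := (continuous_const : Continuous fun _ : G => Inner.inner ℂ η ξ)

end UnitaryRep

/-! ### The Fourier-Stieltjes algebra of a group -/

section GroupFS

variable {G : Type u} [Group G] [TopologicalSpace G]

theorem groupFSNorm_nonneg (f : G → ℂ) : 0 ≤ groupFSNorm f :=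
  Real.sInf_nonneg fun _ ⟨_, _, _, _, hc⟩ => hc ▸ by positivity

theorem UnitaryRep.coeff_mem_groupFS (π : UnitaryRep G) (ξ η : π.space) :
    π.coeff ξ η ∈ groupFS G :=
  ⟨π, ξ, η, rfl⟩

theorem UnitaryRep.groupFSNorm_coeff_le (π : UnitaryRep G) (ξ η : π.space) :
    groupFSNorm (π.coeff ξ η) ≤ ‖ξ‖ * ‖η‖ :=
  csInf_le ⟨0, fun _ ⟨_, _, _, _, hc⟩ => hc ▸ by positivity⟩ ⟨π, ξ, η, rfl, rfl⟩

theorem exists_coeff_of_groupFSNorm_lt {f : G → ℂ} (hf : f ∈ groupFS G) {c : ℝ}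
    (hc : groupFSNorm f < c) :
    ∃ (π : UnitaryRep G) (ξ η : π.space), f = π.coeff ξ η ∧ ‖ξ‖ * ‖η‖ < c := by
  obtain ⟨π, ξ, η, h⟩ := hf
  unfold groupFSNorm at hc
  obtain ⟨_, ⟨π, ξ, η, h, rfl⟩, hlt⟩ := exists_lt_of_csInf_lt (by exact ⟨_, π, ξ, η, h, rfl⟩) hc
  exact ⟨π, ξ, η, h, hlt⟩

theorem UnitaryRep.coeff_smul_left (π : UnitaryRep G) (a : ℂ) (ξ η : π.space) :
    π.coeff (a • ξ) η = a • π.coeff ξ η := by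
  ext x
  simp only [coeff, map_smul, inner_smul_right, Pi.smul_apply, smul_eq_mul]

theorem UnitaryRep.coeff_smul_right (π : UnitaryRep G) (a : ℝ) (ξ η : π.space) :
    π.coeff ξ ((a : ℂ) • η) = (a : ℂ) • π.coeff ξ η := by
  ext x
  simp only [coeff, inner_smul_left, Complex.conj_ofReal, Pi.smul_apply, smul_eq_mul]

/-- A coefficient of norm less than `c` is given by vectors of norm at most `√c`. -/
theorem exists_coeff_sq_le {f : G → ℂ} (hf : f ∈ groupFS G) {c : ℝ} (hc : groupFSNorm f < c) :
    ∃ (π : UnitaryRep G) (ξ η : π.space), f = π.coeff ξ η ∧ ‖ξ‖ ^ 2 ≤ c ∧ ‖η‖ ^ 2 ≤ c := by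
  obtain ⟨π, ξ, η, rfl, hlt⟩ := exists_coeff_of_groupFSNorm_lt hf hc
  have c0 : 0 < c := (groupFSNorm_nonneg _).trans_lt hc
  by_cases hξ : ξ = 0
  -- If one vector vanishes, the coefficient is zero and the other vector may have any length, so
  -- both are replaced by zero.
  · refine ⟨π, 0, 0, ?_, by simpa using c0.le, by simpa using c0.le⟩
    ext x; simp [UnitaryRep.coeff, hξ]
  by_cases hη : η = 0
  · refine ⟨π, 0, 0, ?_, by simpa using c0.le, by simpa using c0.le⟩
    ext x; simp [UnitaryRep.coeff, hη]
  have hξ' : 0 < ‖ξ‖ := norm_pos_iff.2 hξ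
  have hη' : 0 < ‖η‖ := norm_pos_iff.2 hη
  -- With this factor `a • ξ` and `a⁻¹ • η` both have squared norm `‖ξ‖ * ‖η‖`; as `a` is real,
  -- conjugation does not affect the coefficient.
  set a : ℝ := √(‖η‖ / ‖ξ‖) with ha
  have a0 : 0 < a := Real.sqrt_pos.2 (by positivity)
  have ha2 : a ^ 2 = ‖η‖ / ‖ξ‖ := Real.sq_sqrt (by positivity)
  refine ⟨π, (a : ℂ) • ξ, ((a⁻¹ : ℝ) : ℂ) • η, ?_, ?_, ?_⟩
  · rw [UnitaryRep.coeff_smul_left, UnitaryRep.coeff_smul_right, smul_smul, ← Complex.ofReal_mul,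
      mul_inv_cancel₀ a0.ne', Complex.ofReal_one, one_smul]
  · rw [norm_smul, mul_pow, Complex.norm_real, Real.norm_eq_abs, sq_abs, ha2]
    refine le_of_eq_of_le ?_ hlt.le
    field_simp
  · rw [norm_smul, mul_pow, Complex.norm_real, Real.norm_eq_abs, sq_abs, inv_pow, ha2]
    refine le_of_eq_of_le ?_ hlt.le
    field_simp

/-- Cauchy–Schwarz and unitarity. The bound yields definiteness of the box norm and pointwise
convergence of series that converge absolutely in norm. -/
theorem norm_apply_le_groupFSNorm {f : G → ℂ} (hf : f ∈ groupFS G) (x : G) :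
    ‖f x‖ ≤ groupFSNorm f := by
  refine le_of_forall_gt_imp_ge_of_dense fun c hc => ?_
  obtain ⟨π, ξ, η, rfl, hlt⟩ := exists_coeff_of_groupFSNorm_lt hf hc
  refine ((norm_inner_le_norm _ _).trans_eq ?_).trans hlt.le
  rw [LinearIsometryEquiv.norm_map, mul_comm]

/-- Pointwise sums of absolutely convergent series in `B(G)`. -/
theorem groupFS_hasSum {ι : Type} [Countable ι] {f : ι → G → ℂ} (hf : ∀ i, f i ∈ groupFS G)
    (hs : Summable fun i => groupFSNorm (f i)) {F : G → ℂ}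
    (hF : ∀ x, HasSum (fun i => f i x) (F x)) :
    F ∈ groupFS G ∧ groupFSNorm F ≤ ∑' i, groupFSNorm (f i) := by
  have key : ∀ ε : ℝ, 0 < ε →
      F ∈ groupFS G ∧ groupFSNorm F ≤ (∑' i, groupFSNorm (f i)) + ε := by
    intro ε hε
    have := Encodable.ofCountable ι
    -- The error `ε` is split into positive errors `ε' i` of total at most `ε`, one for each term.
    obtain ⟨ε', hε', c, hc, hcε⟩ := posSumOfEncodable hε ι
    choose π ξ η h₁ h₂ h₃ using fun i =>
      exists_coeff_sq_le (hf i) (lt_add_of_pos_right (groupFSNorm (f i)) (hε' i))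
    have hs' := hs.add hc.summable
    have sξ : Summable fun i => ‖ξ i‖ ^ 2 := hs'.of_nonneg_of_le (fun i => by positivity) h₂
    have sη : Summable fun i => ‖η i‖ ^ 2 := hs'.of_nonneg_of_le (fun i => by positivity) h₃
    obtain ⟨σ, v, w, hσ, hv, hw⟩ := UnitaryRep.exists_coeff_eq_tsum π ξ η sξ sη
    have hFσ : F = σ.coeff v w := by
      ext x
      refine (hF x).unique ?_
      simpa only [← h₁] using hσ x
    have hle : ∑' i, (groupFSNorm (f i) + ε' i) ≤ (∑' i, groupFSNorm (f i)) + ε := by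
      rw [hs.tsum_add hc.summable, hc.tsum_eq]
      gcongr
    have hv' := hv.trans_le ((sξ.tsum_le_tsum h₂ hs').trans hle)
    have hw' := hw.trans_le ((sη.tsum_le_tsum h₃ hs').trans hle)
    subst hFσ
    refine ⟨σ.coeff_mem_groupFS v w, (σ.groupFSNorm_coeff_le v w).trans ?_⟩
    -- Both `‖v‖ ^ 2` and `‖w‖ ^ 2` are at most the sum plus `ε`, hence so is `‖v‖ * ‖w‖`, being at
    -- most their mean.
    nlinarith [sq_nonneg (‖v‖ - ‖w‖)]
  exact ⟨(key 1 one_pos).1, le_of_forall_pos_le_add fun ε hε => (key ε hε).2⟩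

theorem groupFS_add {f g : G → ℂ} (hf : f ∈ groupFS G) (hg : g ∈ groupFS G) :
    f + g ∈ groupFS G ∧ groupFSNorm (f + g) ≤ groupFSNorm f + groupFSNorm g := by
  have := groupFS_hasSum (ι := Fin 2) (f := ![f, g]) (F := f + g)
    (by rw [Fin.forall_fin_two]; exact ⟨hf, hg⟩) (Summable.of_finite)
    (fun x => by
      have := hasSum_fintype fun i : Fin 2 => (![f, g] : Fin 2 → G → ℂ) i x
      simpa [Fin.sum_univ_two] using this)
  simpa [tsum_fintype, Fin.sum_univ_two] using this

theorem groupFS_mul {f g : G → ℂ} (hf : f ∈ groupFS G) (hg : g ∈ groupFS G) :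
    f * g ∈ groupFS G ∧ groupFSNorm (f * g) ≤ groupFSNorm f * groupFSNorm g := by
  have key : ∀ ε : ℝ, 0 < ε → f * g ∈ groupFS G ∧
      groupFSNorm (f * g) ≤ (groupFSNorm f + ε) * (groupFSNorm g + ε) := by
    intro ε hε
    obtain ⟨π, ξ, η, h₁, h₂⟩ := exists_coeff_of_groupFSNorm_lt hf (lt_add_of_pos_right _ hε)
    obtain ⟨ρ, ξ', η', h₁', h₂'⟩ := exists_coeff_of_groupFSNorm_lt hg (lt_add_of_pos_right _ hε)
    obtain ⟨σ, v, w, h, hv, hw⟩ := UnitaryRep.exists_coeff_eq_mul π ρ ξ η ξ' η'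
    have hfg : f * g = σ.coeff v w := by rw [h₁, h₁', h]
    rw [hfg]
    refine ⟨σ.coeff_mem_groupFS v w, (σ.groupFSNorm_coeff_le v w).trans ?_⟩
    calc ‖v‖ * ‖w‖ = (‖ξ‖ * ‖η‖) * (‖ξ'‖ * ‖η'‖) := by rw [hv, hw]; ring
      _ ≤ _ := mul_le_mul h₂.le h₂'.le (by positivity)
        (add_nonneg (groupFSNorm_nonneg _) hε.le)
  refine ⟨(key 1 one_pos).1, ?_⟩
  -- The error sits inside both factors, so it is removed by a limit as `ε` decreases to zero.
  have ht : Tendsto (fun ε : ℝ => (groupFSNorm f + ε) * (groupFSNorm g + ε)) (𝓝[>] 0)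
      (𝓝 (groupFSNorm f * groupFSNorm g)) := by
    have : Continuous fun ε : ℝ => (groupFSNorm f + ε) * (groupFSNorm g + ε) := by fun_prop
    simpa using (this.tendsto 0).mono_left nhdsWithin_le_nhds
  exact ge_of_tendsto ht (eventually_mem_nhdsWithin.mono fun ε hε => (key ε hε).2)

theorem groupFS_const (a : ℂ) :
    (fun _ => a) ∈ groupFS G ∧ groupFSNorm (fun _ : G => a) ≤ ‖a‖ := by
  let e : EuclideanSpace ℂ PUnit.{u + 1} := EuclideanSpace.single PUnit.unit 1
  have he : ‖e‖ = 1 := by simp [e]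
  have h : (fun _ : G => a) = (UnitaryRep.trivial (G := G)).coeff (a • e) e := by
    ext x
    change a = inner ℂ e (a • e)
    rw [inner_smul_right, inner_self_eq_norm_sq_to_K, he]
    simp
  rw [h]
  refine ⟨UnitaryRep.coeff_mem_groupFS _ _ _,
    (UnitaryRep.groupFSNorm_coeff_le _ _ _).trans_eq ?_⟩
  change ‖a • e‖ * ‖e‖ = ‖a‖
  rw [norm_smul, he, mul_one, mul_one]

theorem groupFSNorm_zero : groupFSNorm (0 : G → ℂ) = 0 :=
  le_antisymm ((groupFS_const (G := G) 0).2.trans_eq norm_zero) (groupFSNorm_nonneg _)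

/-- Scaling is multiplication by a constant function, which gives `≤`; for nonzero `a`, applying
this to `a⁻¹` gives the reverse inequality. -/
theorem groupFS_smul {f : G → ℂ} (hf : f ∈ groupFS G) (a : ℂ) :
    a • f ∈ groupFS G ∧ groupFSNorm (a • f) = ‖a‖ * groupFSNorm f := by
  have key : ∀ (b : ℂ) {g : G → ℂ}, g ∈ groupFS G →
      b • g ∈ groupFS G ∧ groupFSNorm (b • g) ≤ ‖b‖ * groupFSNorm g := by
    intro b g hg
    have h := groupFS_mul (groupFS_const b).1 hg
    exact ⟨h.1, h.2.trans
      (mul_le_mul_of_nonneg_right (groupFS_const b).2 (groupFSNorm_nonneg g))⟩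
  obtain ⟨hmem, hle⟩ := key a hf
  refine ⟨hmem, le_antisymm hle ?_⟩
  rcases eq_or_ne a 0 with rfl | ha
  · simpa using groupFSNorm_nonneg _
  have h := (key a⁻¹ hmem).2
  rw [inv_smul_smul₀ ha, norm_inv] at h
  have := mul_le_mul_of_nonneg_left h (norm_nonneg a)
  rwa [mul_inv_cancel_left₀ (norm_ne_zero_iff.2 ha)] at this

end GroupFS

/-- Cauchy sequences for an algebra norm converge if absolutely convergent series do. -/
theorem AlgebraNorm.exists_tendsto_of_cauchy {A : Type*} [Ring A] [Algebra ℂ A]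
    (N : AlgebraNorm ℂ A)
    (h : ∀ v : ℕ → A, (Summable fun n => N (v n)) →
      ∃ g, Tendsto (fun n => N ((∑ i ∈ Finset.range n, v i) - g)) atTop (𝓝 0))
    (f : ℕ → A) (hf : ∀ ε : ℝ, 0 < ε → ∃ n₀, ∀ m ≥ n₀, ∀ n ≥ n₀, N (f m - f n) < ε) :
    ∃ g, Tendsto (fun n => N (f n - g)) atTop (𝓝 0) := by
  -- Turning `N` into the norm of `A` makes available the completeness criterion by absolutely
  -- convergent series.
  let _ : NormedRing A := N.toRingNorm.toNormedRing
  have hnorm (g : A) : ‖g‖ = N g := rfl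
  have : CompleteSpace A := by
    refine NormedAddCommGroup.completeSpace_of_summable_imp_tendsto fun v hv => ?_
    obtain ⟨g, hg⟩ := h v hv
    exact ⟨g, tendsto_iff_norm_sub_tendsto_zero.2 hg⟩
  have hc : CauchySeq f := by
    refine Metric.cauchySeq_iff.2 fun ε hε => ?_
    simpa only [dist_eq_norm, hnorm] using hf ε hε
  obtain ⟨g, hg⟩ := cauchySeq_tendsto_of_complete hc
  exact ⟨g, tendsto_iff_norm_sub_tendsto_zero.1 hg⟩

namespace GroupBundle

variable {T : Type u} {G : T → Type u} [∀ t, Group (G t)] [∀ t, TopologicalSpace (G t)]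

/-! ### The box sum as a Banach algebra -/

theorem mem_boxSum_iff {f : GroupBundle G → ℂ} :
    f ∈ boxSum G ↔ (∀ t, restrict t f ∈ groupFS (G t)) ∧
      BddAbove (Set.range fun t => groupFSNorm (restrict t f)) := by
  constructor
  · rintro ⟨u, hu, hb, rfl⟩
    exact ⟨hu, hb⟩
  · rintro ⟨hu, hb⟩
    exact ⟨fun t => restrict t f, hu, hb, rfl⟩

theorem mem_boxSum_of_le {f : GroupBundle G → ℂ} (hf : ∀ t, restrict t f ∈ groupFS (G t)) {c : ℝ}
    (hc : ∀ t, groupFSNorm (restrict t f) ≤ c) : f ∈ boxSum G :=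
  mem_boxSum_iff.2 ⟨hf, c, by rintro _ ⟨t, rfl⟩; exact hc t⟩

theorem boxNorm_nonneg (f : GroupBundle G → ℂ) : 0 ≤ boxNorm f :=
  Real.iSup_nonneg fun _ => groupFSNorm_nonneg _

theorem groupFSNorm_restrict_le {f : GroupBundle G → ℂ} (hf : f ∈ boxSum G) (t : T) :
    groupFSNorm (restrict t f) ≤ boxNorm f :=
  le_ciSup (mem_boxSum_iff.1 hf).2 t

/-- The condition `0 ≤ c` covers an empty `T`, where the real supremum is `0`. -/
theorem boxNorm_le {f : GroupBundle G → ℂ} {c : ℝ} (hc : 0 ≤ c)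
    (h : ∀ t, groupFSNorm (restrict t f) ≤ c) : boxNorm f ≤ c :=
  Real.iSup_le h hc

theorem norm_apply_le_boxNorm {f : GroupBundle G → ℂ} (hf : f ∈ boxSum G) (x : GroupBundle G) :
    ‖f x‖ ≤ boxNorm f :=
  (norm_apply_le_groupFSNorm ((mem_boxSum_iff.1 hf).1 x.1) x.2).trans
    (groupFSNorm_restrict_le hf x.1)

theorem boxSum_add {f g : GroupBundle G → ℂ} (hf : f ∈ boxSum G) (hg : g ∈ boxSum G) :
    f + g ∈ boxSum G ∧ boxNorm (f + g) ≤ boxNorm f + boxNorm g := by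
  have key t := groupFS_add ((mem_boxSum_iff.1 hf).1 t) ((mem_boxSum_iff.1 hg).1 t)
  have hle t : groupFSNorm (restrict t (f + g)) ≤ boxNorm f + boxNorm g :=
    (key t).2.trans (add_le_add (groupFSNorm_restrict_le hf t) (groupFSNorm_restrict_le hg t))
  exact ⟨mem_boxSum_of_le (fun t => (key t).1) hle,
    boxNorm_le (add_nonneg (boxNorm_nonneg f) (boxNorm_nonneg g)) hle⟩

theorem boxSum_mul {f g : GroupBundle G → ℂ} (hf : f ∈ boxSum G) (hg : g ∈ boxSum G) :
    f * g ∈ boxSum G ∧ boxNorm (f * g) ≤ boxNorm f * boxNorm g := by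
  have key t := groupFS_mul ((mem_boxSum_iff.1 hf).1 t) ((mem_boxSum_iff.1 hg).1 t)
  have hle t : groupFSNorm (restrict t (f * g)) ≤ boxNorm f * boxNorm g :=
    (key t).2.trans (mul_le_mul (groupFSNorm_restrict_le hf t) (groupFSNorm_restrict_le hg t)
      (groupFSNorm_nonneg _) (boxNorm_nonneg f))
  exact ⟨mem_boxSum_of_le (fun t => (key t).1) hle,
    boxNorm_le (mul_nonneg (boxNorm_nonneg f) (boxNorm_nonneg g)) hle⟩

theorem boxNorm_smul {f : GroupBundle G → ℂ} (hf : f ∈ boxSum G) (a : ℂ) :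
    boxNorm (a • f) = ‖a‖ * boxNorm f := by
  rw [boxNorm, boxNorm, Real.mul_iSup_of_nonneg (norm_nonneg a)]
  exact iSup_congr fun t => (groupFS_smul ((mem_boxSum_iff.1 hf).1 t) a).2

theorem const_mem_boxSum (a : ℂ) : (fun _ => a) ∈ boxSum G :=
  mem_boxSum_of_le (fun _ => (groupFS_const a).1) fun _ => (groupFS_const a).2

theorem boxNorm_zero : boxNorm (0 : GroupBundle G → ℂ) = 0 :=
  le_antisymm (boxNorm_le le_rfl fun _ => groupFSNorm_zero.le) (boxNorm_nonneg _)

/-- The norms of the restrictions to each group are dominated by the box norms, so the series bound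
on each `B(G_t)` holds with a constant independent of `t`. -/
theorem boxSum_hasSum {f : ℕ → GroupBundle G → ℂ} (hf : ∀ n, f n ∈ boxSum G)
    (hs : Summable fun n => boxNorm (f n)) {F : GroupBundle G → ℂ}
    (hF : ∀ x, HasSum (fun n => f n x) (F x)) :
    F ∈ boxSum G ∧ boxNorm F ≤ ∑' n, boxNorm (f n) := by
  have hst t : Summable fun n => groupFSNorm (restrict t (f n)) :=
    hs.of_nonneg_of_le (fun n => groupFSNorm_nonneg _) fun n => groupFSNorm_restrict_le (hf n) t
  have key t := groupFS_hasSum (F := restrict t F) (fun n => (mem_boxSum_iff.1 (hf n)).1 t) (hst t)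
    fun x => hF (mk t x)
  have hle t : groupFSNorm (restrict t F) ≤ ∑' n, boxNorm (f n) :=
    (key t).2.trans ((hst t).tsum_le_tsum (fun n => groupFSNorm_restrict_le (hf n) t) hs)
  exact ⟨mem_boxSum_of_le (fun t => (key t).1) hle,
    boxNorm_le (tsum_nonneg fun n => boxNorm_nonneg _) hle⟩

variable (G) in
/-- The box sum as a subalgebra of the algebra of functions on the bundle. -/
def boxSubalgebra : Subalgebra ℂ (GroupBundle G → ℂ) where
  carrier := boxSum G
  add_mem' hf hg := (boxSum_add hf hg).1
  mul_mem' hf hg := (boxSum_mul hf hg).1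
  algebraMap_mem' a := const_mem_boxSum a

variable (G) in
/-- The box norm as an algebra norm. -/
noncomputable def boxAlgebraNorm : AlgebraNorm ℂ (boxSubalgebra G) where
  toFun f := boxNorm (f : GroupBundle G → ℂ)
  map_zero' := boxNorm_zero
  add_le' f g := (boxSum_add f.2 g.2).2
  neg' f := by simpa using boxNorm_smul f.2 (-1)
  mul_le' f g := (boxSum_mul f.2 g.2).2
  smul' a f := boxNorm_smul f.2 a
  eq_zero_of_map_eq_zero' f hf := by
    ext x
    simpa [hf] using norm_apply_le_boxNorm f.2 x

/-- Absolutely convergent series converge in the box sum. -/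
theorem exists_tendsto_boxAlgebraNorm (f : ℕ → boxSubalgebra G)
    (hs : Summable fun n => boxAlgebraNorm G (f n)) :
    ∃ g : boxSubalgebra G,
      Tendsto (fun n => boxAlgebraNorm G ((∑ i ∈ Finset.range n, f i) - g)) atTop (𝓝 0) := by
  have hsx (x : GroupBundle G) : Summable fun n => (f n : GroupBundle G → ℂ) x :=
    Summable.of_norm_bounded hs fun n => norm_apply_le_boxNorm (f n).2 x
  let F : GroupBundle G → ℂ := fun x => ∑' n, (f n : GroupBundle G → ℂ) x
  have hF := (boxSum_hasSum (fun n => (f n).2) hs (F := F) fun x => (hsx x).hasSum).1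
  refine ⟨⟨F, hF⟩, ?_⟩
  refine squeeze_zero (fun n => boxNorm_nonneg _) (fun n => ?_)
    (tendsto_sum_nat_add fun n => boxAlgebraNorm G (f n))
  -- In this order the difference is the tail of the series, whose norm is at most the tail of the
  -- series of norms.
  rw [map_sub_rev]
  refine (boxSum_hasSum (f := fun k => (f (k + n) : GroupBundle G → ℂ)) (fun k => (f (k + n)).2)
    ((summable_nat_add_iff n).2 hs) fun x => ?_).2
  have h := (hasSum_nat_add_iff' n).2 (hsx x).hasSum
  have e : ((((⟨F, hF⟩ : boxSubalgebra G) - ∑ i ∈ Finset.range n, f i : boxSubalgebra G) :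
      GroupBundle G → ℂ)) x =
      F x - ∑ i ∈ Finset.range n, (f i : GroupBundle G → ℂ) x := by
    simp
  rwa [e]

variable (G) in
/-- The box sum as a Banach algebra. -/
noncomputable def boxBanachAlgebra : BanachFunctionAlgebra (GroupBundle G) where
  alg := boxSubalgebra G
  norm := boxAlgebraNorm G
  complete := (boxAlgebraNorm G).exists_tendsto_of_cauchy exists_tendsto_boxAlgebraNorm

end GroupBundle

/-! ### Hilbert fields and groupoid representations. -/

/-- Over a discrete space every section of a continuous Hilbert field is continuous. -/
theorem ContinuousHilbertField.mem_sections {S : Type u} [TopologicalSpace S] [DiscreteTopology S]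
    (H : ContinuousHilbertField S) (x : ∀ t, H.fiber t) : x ∈ H.sections := by
  refine H.mem_of_locally_approx x fun t ε hε => ?_
  obtain ⟨v, ⟨x', hx', rfl⟩, hv⟩ := (H.dense t).exists_dist_lt (x t) hε
  refine ⟨x', hx', ?_⟩
  -- Neighbourhoods reduce to single points, so density in one fibre is enough.
  rw [nhds_discrete]
  exact (dist_eq_norm (x t) (x' t)).symm.trans_lt hv

theorem ContinuousHilbertField.norm_le_sectionNorm {S : Type u} [TopologicalSpace S]
    {H : ContinuousHilbertField S} {ξ : ∀ t, H.fiber t} (hξ : ξ ∈ H.boundedSections) (t : S) :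
    ‖ξ t‖ ≤ H.sectionNorm ξ :=
  le_ciSup hξ.2 t

theorem ContinuousHilbertField.sectionNorm_nonneg {S : Type u} [TopologicalSpace S]
    (H : ContinuousHilbertField S) (ξ : ∀ t, H.fiber t) : 0 ≤ H.sectionNorm ξ :=
  Real.iSup_nonneg fun _ => norm_nonneg _

-- Sources and ranges are equal to the given units only propositionally. Free units with equality
-- proofs allow `subst` to remove the transports between fibres, and let all operators of one `G_t`
-- act on a single fibre.
open PartialGroupoid in
theorem GroupoidRep.op_prod_apply {𝒢 : Type u} [PartialGroupoid 𝒢] [TopologicalSpace 𝒢]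
    (ϖ : GroupoidRep 𝒢) {x y : 𝒢} (h : (x, y) ∈ composable (𝒢 := 𝒢)) {u v w : unitSpace 𝒢}
    (hyu : source y = u) (hyv : range y = v) (hxv : source x = v) (hxw : range x = w)
    (hu : source (prod x y h) = u) (hw : range (prod x y h) = w) (ζ : ϖ.field.fiber u) :
    ϖ.op (prod x y h) u w hu hw ζ = ϖ.op x v w hxv hxw (ϖ.op y u v hyu hyv ζ) := by
  subst hyu hyv hxw
  exact ϖ.op_prod x y h ζ

open PartialGroupoid in
theorem GroupoidRep.coeff_eq {𝒢 : Type u} [PartialGroupoid 𝒢] [TopologicalSpace 𝒢]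
    (ϖ : GroupoidRep 𝒢) (ξ η : ∀ u, ϖ.field.fiber u) {x : 𝒢} {u v : unitSpace 𝒢}
    (hu : source x = u) (hv : range x = v) :
    ϖ.coeff ξ η x = inner ℂ (η v) (ϖ.op x u v hu hv (ξ u)) := by
  subst hu hv
  rfl

namespace GroupBundle

variable {T : Type u} {G : T → Type u} [∀ t, Group (G t)]

open PartialGroupoid

/-! ### The unit space of a group bundle -/

theorem composable_mk (t : T) (x y : G t) :
    (mk t x, mk t y) ∈ composable (𝒢 := GroupBundle G) := rfl

variable (G) in
/-- The unit of `G_t`, as a unit of the bundle. -/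
def unitOf (t : T) : unitSpace (GroupBundle G) := range (mk t 1)

theorem range_mk (t : T) (x : G t) : range (mk t x) = unitOf G t := by
  apply Subtype.ext
  exact congrArg (mk t) ((_root_.mul_inv_cancel x).trans (_root_.mul_inv_cancel 1).symm)

theorem source_mk (t : T) (x : G t) : source (mk t x) = unitOf G t := by
  apply Subtype.ext
  exact congrArg (mk t) ((_root_.inv_mul_cancel x).trans (_root_.mul_inv_cancel 1).symm)

theorem unitOf_injective : Function.Injective (unitOf G) := fun _ _ h =>
  congrArg (fun u : unitSpace (GroupBundle G) => u.1.1) h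

section Topology

variable [TopologicalSpace (GroupBundle G)]

theorem continuous_range [IsTopologicalGroupoid (GroupBundle G)] :
    Continuous (range : GroupBundle G → unitSpace (GroupBundle G)) :=
  Continuous.subtype_mk (IsTopologicalGroupoid.continuous_mul.comp
    (Continuous.subtype_mk (continuous_id.prodMk IsTopologicalGroupoid.continuous_inv)
      composable_inv)) _

variable [∀ t, TopologicalSpace (G t)]

/-- If the unit space is discrete, the groups of the bundle are open. -/
theorem isOpenEmbedding_mk [IsTopologicalGroupoid (GroupBundle G)]
    [DiscreteTopology (unitSpace (GroupBundle G))]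
    (hG : ∀ t, IsEmbedding (mk t : G t → GroupBundle G)) (t : T) :
    IsOpenEmbedding (mk t : G t → GroupBundle G) := by
  refine ⟨hG t, ?_⟩
  -- The copy of `G_t` is the fibre of the range map over its unit, and a point of a discrete space
  -- is open.
  have h : Set.range (mk t : G t → GroupBundle G) = range ⁻¹' {unitOf G t} := by
    ext ⟨s, x⟩
    constructor
    · rintro ⟨y, hy⟩
      rw [← hy]
      exact range_mk t y
    · intro hx
      obtain rfl : s = t := unitOf_injective ((range_mk s x).symm.trans hx)
      exact ⟨x, rfl⟩
  rw [h]
  exact (isOpen_discrete _).preimage continuous_range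

theorem continuous_of_comp_mk [IsTopologicalGroupoid (GroupBundle G)]
    [DiscreteTopology (unitSpace (GroupBundle G))]
    (hG : ∀ t, IsEmbedding (mk t : G t → GroupBundle G)) {f : GroupBundle G → ℂ}
    (hf : ∀ t, Continuous fun x : G t => f (mk t x)) : Continuous f := by
  refine continuous_iff_continuousAt.2 fun x => ?_
  exact ((isOpenEmbedding_mk hG x.1).continuousAt_iff (x := x.2)).1 (hf x.1).continuousAt

end Topology

/-! ### Restriction of representations of the bundle -/

section Restriction

variable [TopologicalSpace (GroupBundle G)]

/-- The unitaries attached to the elements of `G_t` by a representation of the bundle. -/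
noncomputable def restrictIsometry (ϖ : GroupoidRep (GroupBundle G)) (t : T) (x : G t) :
    ϖ.field.fiber (unitOf G t) →ₗᵢ[ℂ] ϖ.field.fiber (unitOf G t) :=
  (ϖ.op (mk t x) (unitOf G t) (unitOf G t) (source_mk t x) (range_mk t x)).toLinearIsometry

theorem restrictIsometry_mul (ϖ : GroupoidRep (GroupBundle G)) (t : T) (x y : G t)
    (v : ϖ.field.fiber (unitOf G t)) :
    restrictIsometry ϖ t (x * y) v = restrictIsometry ϖ t x (restrictIsometry ϖ t y v) :=
  ϖ.op_prod_apply (composable_mk t x y) (source_mk t y) (range_mk t y) (source_mk t x)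
    (range_mk t x) _ _ v

theorem restrictIsometry_one (ϖ : GroupoidRep (GroupBundle G)) (t : T)
    (v : ϖ.field.fiber (unitOf G t)) : restrictIsometry ϖ t 1 v = v := by
  -- The operator at the identity is idempotent and injective, hence the identity.
  apply (restrictIsometry ϖ t 1).injective
  rw [← restrictIsometry_mul, mul_one]

variable [∀ t, TopologicalSpace (G t)] [DiscreteTopology (unitSpace (GroupBundle G))]

open Classical in
/-- The restriction to `G_t` of a representation of the bundle. -/
noncomputable def restrictRep (hG : ∀ t, IsEmbedding (mk t : G t → GroupBundle G))
    (ϖ : GroupoidRep (GroupBundle G)) (t : T) : UnitaryRep (G t) where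
  space := ϖ.field.fiber (unitOf G t)
  op := unitaryHom (restrictIsometry ϖ t) (restrictIsometry_one ϖ t) (restrictIsometry_mul ϖ t)
  continuous_coeff v w := by
    -- Any vector of the fibre extends by zero to a bounded section, which is continuous because the
    -- unit space is discrete.
    have mem (v : ϖ.field.fiber (unitOf G t)) :
        (Pi.single (unitOf G t) v : ∀ u, ϖ.field.fiber u) ∈ ϖ.field.boundedSections := by
      refine ⟨ϖ.field.mem_sections _, ‖v‖, ?_⟩
      rintro _ ⟨u, rfl⟩
      rcases eq_or_ne u (unitOf G t) with rfl | hu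
      · simp
      · simp [Pi.single_eq_of_ne hu]
    have h := (ϖ.continuous_coeff _ (mem v) _ (mem w)).comp (hG t).continuous
    refine h.congr fun x => ?_
    refine (ϖ.coeff_eq _ _ (source_mk t x) (range_mk t x)).trans ?_
    rw [Pi.single_eq_same, Pi.single_eq_same]
    rfl

theorem restrict_coeff (hG : ∀ t, IsEmbedding (mk t : G t → GroupBundle G))
    (ϖ : GroupoidRep (GroupBundle G)) (ξ η : ∀ u, ϖ.field.fiber u) (t : T) :
    restrict t (ϖ.coeff ξ η) =
      (restrictRep hG ϖ t).coeff (ξ (unitOf G t)) (η (unitOf G t)) := by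
  ext x
  exact ϖ.coeff_eq ξ η (source_mk t x) (range_mk t x)

theorem groupFSNorm_restrict_coeff_le (hG : ∀ t, IsEmbedding (mk t : G t → GroupBundle G))
    (ϖ : GroupoidRep (GroupBundle G)) {ξ η : ∀ u, ϖ.field.fiber u}
    (hξ : ξ ∈ ϖ.field.boundedSections) (hη : η ∈ ϖ.field.boundedSections) (t : T) :
    groupFSNorm (restrict t (ϖ.coeff ξ η)) ≤ ϖ.field.sectionNorm ξ * ϖ.field.sectionNorm η := by
  rw [restrict_coeff hG]
  refine (UnitaryRep.groupFSNorm_coeff_le _ _ _).trans ?_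
  exact mul_le_mul (ContinuousHilbertField.norm_le_sectionNorm hξ _)
    (ContinuousHilbertField.norm_le_sectionNorm hη _) (norm_nonneg _)
    (ϖ.field.sectionNorm_nonneg ξ)

end Restriction

/-! ### The representation of the bundle given by representations of the groups -/

section Assembly

variable [∀ t, TopologicalSpace (G t)]

/-- The unitary attached to an element of the bundle by representations of the groups. -/
noncomputable def assembledOp (π : ∀ t, UnitaryRep (G t)) (x : GroupBundle G) {s t : T}
    (hs : x.1 = s) (ht : x.1 = t) : (π s).space ≃ₗᵢ[ℂ] (π t).space := by
  subst hs
  exact ht ▸ (π x.1).op x.2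

/-- The indices `r`, `s`, `t` are kept free so that substitution turns every cast into the identity,
leaving multiplicativity of one `π t`. -/
theorem assembledOp_prod (π : ∀ t, UnitaryRep (G t)) {x y : GroupBundle G}
    (h : (x, y) ∈ composable (𝒢 := GroupBundle G)) {r s t : T} (hr : y.1 = r) (hs : y.1 = s)
    (hs' : x.1 = s) (ht : x.1 = t) (hpr : (prod x y h).1 = r) (hpt : (prod x y h).1 = t)
    (v : (π r).space) :
    assembledOp π (prod x y h) hpr hpt v = assembledOp π x hs' ht (assembledOp π y hr hs v) := by
  obtain ⟨t, x⟩ := x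
  obtain ⟨s, y⟩ := y
  obtain rfl : t = s := h
  subst hr hs ht
  exact (π t).op_mul_apply x y v

variable [TopologicalSpace (GroupBundle G)] [DiscreteTopology (unitSpace (GroupBundle G))]

/-- The Hilbert field formed by the spaces of representations of the groups. -/
noncomputable def assembledField (π : ∀ t, UnitaryRep (G t)) :
    ContinuousHilbertField (unitSpace (GroupBundle G)) where
  fiber u := (π u.1.1).space
  sections := ⊤
  dense t := by
    classical
    refine dense_univ.mono fun v _ => ⟨Pi.single t v, trivial, Pi.single_eq_same _ _⟩
  continuous_norm _ _ := continuous_of_discreteTopology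
  mem_of_locally_approx _ _ := trivial

theorem inner_assembledOp (π : ∀ t, UnitaryRep (G t))
    (ξ η : ∀ u, (assembledField π).fiber u) {x : GroupBundle G}
    {u v : unitSpace (GroupBundle G)} (hu : source x = u) (hv : range x = v) :
    inner ℂ (η (range x)) (assembledOp π x rfl rfl (ξ (source x))) =
      inner ℂ (η v) (assembledOp π x (congrArg (fun w => w.1.1) hu)
        (congrArg (fun w => w.1.1) hv) (ξ u)) := by
  subst hu hv
  rfl

/-- The representation of the bundle formed by representations of the groups. -/
noncomputable def assembledRep [IsTopologicalGroupoid (GroupBundle G)]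
    (hG : ∀ t, IsEmbedding (mk t : G t → GroupBundle G)) (π : ∀ t, UnitaryRep (G t)) :
    GroupoidRep (GroupBundle G) where
  field := assembledField π
  op x u v hu hv := assembledOp π x (congrArg (fun w => w.1.1) hu) (congrArg (fun w => w.1.1) hv)
  continuous_coeff ξ _ η _ := by
    refine continuous_of_comp_mk hG fun t => ?_
    refine ((π t).continuous_coeff (ξ (unitOf G t)) (η (unitOf G t))).congr fun x => ?_
    exact (inner_assembledOp π ξ η (source_mk t x) (range_mk t x)).symm
  op_prod x y h v := assembledOp_prod π h _ _ _ _ _ _ v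

/-- A strict bound common to all `t` allows both vectors to be chosen of norm at most `√c` in every
fibre, so each of the two sections is bounded on its own. -/
theorem exists_groupoidRep_coeff [IsTopologicalGroupoid (GroupBundle G)]
    (hG : ∀ t, IsEmbedding (mk t : G t → GroupBundle G)) {f : GroupBundle G → ℂ}
    (hf : ∀ t, restrict t f ∈ groupFS (G t)) {c : ℝ} (hc : 0 ≤ c)
    (hfc : ∀ t, groupFSNorm (restrict t f) < c) :
    ∃ ϖ : GroupoidRep (GroupBundle G), ∃ ξ ∈ ϖ.field.boundedSections,
      ∃ η ∈ ϖ.field.boundedSections,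
        f = ϖ.coeff ξ η ∧ ϖ.field.sectionNorm ξ * ϖ.field.sectionNorm η ≤ c := by
  choose π ξ η h hξ hη using fun t => exists_coeff_sq_le (hf t) (hfc t)
  have hξ' t : ‖ξ t‖ ≤ √c := Real.le_sqrt_of_sq_le (hξ t)
  have hη' t : ‖η t‖ ≤ √c := Real.le_sqrt_of_sq_le (hη t)
  refine ⟨assembledRep hG π, fun u => ξ u.1.1, ⟨trivial, √c, ?_⟩, fun u => η u.1.1,
    ⟨trivial, √c, ?_⟩, ?_, ?_⟩
  · rintro _ ⟨u, rfl⟩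
    exact hξ' u.1.1
  · rintro _ ⟨u, rfl⟩
    exact hη' u.1.1
  · ext x
    exact congrFun (h x.1) x.2
  · rw [← Real.mul_self_sqrt hc]
    exact mul_le_mul (Real.iSup_le (fun u => hξ' u.1.1) (Real.sqrt_nonneg c))
      (Real.iSup_le (fun u => hη' u.1.1) (Real.sqrt_nonneg c))
      (ContinuousHilbertField.sectionNorm_nonneg _ _) (Real.sqrt_nonneg c)

end Assembly

/-! ### Equality of the two algebras and of their norms. -/

section Comparison

variable [∀ t, TopologicalSpace (G t)] [TopologicalSpace (GroupBundle G)]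
  [IsTopologicalGroupoid (GroupBundle G)] [DiscreteTopology (unitSpace (GroupBundle G))]

theorem exists_groupoidRep_coeff_of_mem_boxSum
    (hG : ∀ t, IsEmbedding (mk t : G t → GroupBundle G)) {f : GroupBundle G → ℂ}
    (hf : f ∈ boxSum G) {ε : ℝ} (hε : 0 < ε) :
    ∃ ϖ : GroupoidRep (GroupBundle G), ∃ ξ ∈ ϖ.field.boundedSections,
      ∃ η ∈ ϖ.field.boundedSections,
        f = ϖ.coeff ξ η ∧ ϖ.field.sectionNorm ξ * ϖ.field.sectionNorm η ≤ boxNorm f + ε :=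
  exists_groupoidRep_coeff hG (mem_boxSum_iff.1 hf).1 (add_nonneg (boxNorm_nonneg f) hε.le)
    fun t => (groupFSNorm_restrict_le hf t).trans_lt (lt_add_of_pos_right _ hε)

theorem groupoidFS_eq_boxSum (hG : ∀ t, IsEmbedding (mk t : G t → GroupBundle G)) :
    groupoidFS (GroupBundle G) = boxSum G := by
  ext f
  constructor
  · rintro ⟨ϖ, ξ, hξ, η, hη, rfl⟩
    refine mem_boxSum_of_le (fun t => ?_) (groupFSNorm_restrict_coeff_le hG ϖ hξ hη)
    rw [restrict_coeff hG]
    exact UnitaryRep.coeff_mem_groupFS _ _ _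
  · intro hf
    obtain ⟨ϖ, ξ, hξ, η, hη, h, -⟩ := exists_groupoidRep_coeff_of_mem_boxSum hG hf one_pos
    exact ⟨ϖ, ξ, hξ, η, hη, h⟩

theorem groupoidFSNorm_eq_boxNorm (hG : ∀ t, IsEmbedding (mk t : G t → GroupBundle G))
    {f : GroupBundle G → ℂ} (hf : f ∈ boxSum G) : groupoidFSNorm f = boxNorm f := by
  apply le_antisymm
  · refine le_of_forall_pos_le_add fun ε hε => ?_
    obtain ⟨ϖ, ξ, hξ, η, hη, h, hle⟩ := exists_groupoidRep_coeff_of_mem_boxSum hG hf hε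
    unfold groupoidFSNorm
    refine le_trans (csInf_le ⟨0, ?_⟩ (by exact ⟨ϖ, ξ, hξ, η, hη, h, rfl⟩)) hle
    rintro _ ⟨ϖ, ξ, -, η, -, -, rfl⟩
    exact mul_nonneg (ϖ.field.sectionNorm_nonneg ξ) (ϖ.field.sectionNorm_nonneg η)
  -- This realisation, with `ε = 1`, only shows that the infimum is over a nonempty set; the
  -- inequality holds because every realisation bounds all the restrictions.
  · obtain ⟨ϖ, ξ, hξ, η, hη, h, -⟩ := exists_groupoidRep_coeff_of_mem_boxSum hG hf one_pos
    unfold groupoidFSNorm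
    refine le_csInf (by exact ⟨_, ϖ, ξ, hξ, η, hη, h, rfl⟩) ?_
    rintro _ ⟨ϖ, ξ, hξ, η, hη, rfl, rfl⟩
    exact boxNorm_le (mul_nonneg (ϖ.field.sectionNorm_nonneg ξ) (ϖ.field.sectionNorm_nonneg η))
      (groupFSNorm_restrict_coeff_le hG ϖ hξ hη)

end Comparison

end GroupBundle

theorem mainTheorem8 {T : Type u} (G : T → Type u) [∀ t, Group (G t)]
    [∀ t, TopologicalSpace (G t)] [∀ t, IsTopologicalGroup (G t)]
    [∀ t, LocallyCompactSpace (G t)] [∀ t, T2Space (G t)]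
    [TopologicalSpace (GroupBundle G)] [IsTopologicalGroupoid (GroupBundle G)]
    [LocallyCompactSpace (GroupBundle G)] [T2Space (GroupBundle G)]
    (hG : ∀ t, Topology.IsEmbedding (GroupBundle.mk t : G t → GroupBundle G))
    (hdisc : DiscreteTopology (PartialGroupoid.unitSpace (GroupBundle G))) :
    ∃ B L : BanachFunctionAlgebra (GroupBundle G),
      (B.alg : Set (GroupBundle G → ℂ)) = groupoidFS (GroupBundle G) ∧
      (∀ φ : B.alg, B.norm φ = groupoidFSNorm (φ : GroupBundle G → ℂ)) ∧
      (L.alg : Set (GroupBundle G → ℂ)) = GroupBundle.boxSum G ∧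
      (∀ f : L.alg, L.norm f = GroupBundle.boxNorm (f : GroupBundle G → ℂ)) ∧
      ∃ Φ : B.alg ≃ₐ[ℂ] L.alg,
        (∀ φ : B.alg, L.norm (Φ φ) = B.norm φ) ∧
        ∀ φ : B.alg, (Φ φ : GroupBundle G → ℂ) =
          GroupBundle.boxplus fun t => GroupBundle.restrict t (φ : GroupBundle G → ℂ) :=
  -- Both algebras are the box sum, and `Φ` is the identity, since a function on the bundle is the
  -- box sum of its own restrictions.
  ⟨GroupBundle.boxBanachAlgebra G, GroupBundle.boxBanachAlgebra G,
    (GroupBundle.groupoidFS_eq_boxSum hG).symm,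
    fun φ => (GroupBundle.groupoidFSNorm_eq_boxNorm hG φ.2).symm, rfl, fun _ => rfl,
    AlgEquiv.refl, fun _ => rfl, fun _ => rfl⟩
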